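/- Let $p\ge 1$, $0<\alpha<2$, $\mu\in\mathbb R^p$, and let $\Sigma$ be a symmetric positive semi-definite $p\times p$ matrix with $\Sigma_{kk}\neq 0$ for all $k$. Let $x_1,x_2,\dots$ be i.i.d. random vectors in $\mathbb R^p$ with the sub-Gaussian stable law $S_p(\mu,\Sigma,\alpha)$, i.e. with characteristic function $\phi(t)=\exp\{i t^\top\mu-(\tfrac12 t^\top\Sigma t)^{\alpha/2}\}$. Let $\hat\phi_n(t)=\frac1n\sum_{j=1}^n e^{it^\top x_j}$, let $e_1,\dots,e_p$ be the standard basis, and let $s_1,s_2$ be nonzero reals with $|s_1|\ne|s_2|$; put $L=\log|s_1/s_2|$. Define $$\hat\alpha^{mult}=\frac1p\sum_{k=1}^p\frac1L\log\frac{\log|\hat\phi_n(s_1e_k)|}{\log|\hat\phi_n(s_2e_k)|},\qquad \hat\Sigma_{jj}=\frac{2}{s_1^2}\bigl(-\log|\hat\phi_n(s_1e_j)|\bigr)^{2/\hat\alpha^{mult}},$$ $$\hat\Sigma_{ij}=\tfrac12\Bigl[\bigl(-\log|\hat\phi_n(e_i+e_j)|\bigr)^{2/\hat\alpha^{mult}}-\bigl(-\log|\hat\phi_n(e_i-e_j)|\bigr)^{2/\hat\alpha^{mult}}\Bigr]\quad(j<i)$$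 (on the event, of probability tending to $0$, where these expressions are undefined, they are given conventional values). Let $\Sigma_d$ be the vector of diagonal entries and $\Sigma_{nd}$ the vector of the entries $\Sigma_{ij}$, $j<i$, listed row by row; similarly $\hat\Sigma_d,\hat\Sigma_{nd}$. Then, as $n\to\infty$, $$\sqrt n\begin{pmatrix}\hat\alpha^{mult}-\alpha\\ \hat\Sigma_d-\Sigma_d\\ \hat\Sigma_{nd}-\Sigma_{nd}\end{pmatrix}\xrightarrow{d}\mathcal N_{p(p+1)/2+1}\bigl(0,\;G\,\Omega\,G^\top\bigr),$$ with the positive semi-definite matrix $G\Omega G^\top$ given as follows. Let $t_1,\dots,t_m$, $m=p^2+p$, be the points $s_1e_k$ $(k\le p)$, $s_2e_k$ $(k\le p)$, $e_i+e_j$ $(j<i)$, $e_i-e_j$ $(j<i)$, in this order. $\Omega=\begin{pmatrix}\Omega_{Re}&\Omega_{RI}\\ \Omega_{RI}^\top&\Omega_{Im}\end{pmatrix}$ is the covariance matrix of $(\operatorname{Re}e^{it_1^\top x_1},\dots,\operatorname{Re}e^{it_m^\top x_1},\operatorname{Im}e^{it_1^\top x_1},\dots,\operatorname{Im}e^{it_m^\top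 x_1})$, that is, $$[\Omega_{Re}]_{jk}=\tfrac12\operatorname{Re}\phi(t_j+t_k)+\tfrac12\operatorname{Re}\phi(t_k-t_j)-\operatorname{Re}\phi(t_j)\operatorname{Re}\phi(t_k),$$ $$[\Omega_{Im}]_{jk}=-\tfrac12\operatorname{Re}\phi(t_j+t_k)+\tfrac12\operatorname{Re}\phi(t_k-t_j)-\operatorname{Im}\phi(t_j)\operatorname{Im}\phi(t_k),$$ $$[\Omega_{RI}]_{jk}=\tfrac12\operatorname{Im}\phi(t_j+t_k)+\tfrac12\operatorname{Im}\phi(t_k-t_j)-\operatorname{Re}\phi(t_j)\operatorname{Im}\phi(t_k).$$ $G$ is the $(\frac{p(p+1)}2+1)\times 2m$ Jacobian matrix, at the true values $(\operatorname{Re}\phi(t_c),\operatorname{Im}\phi(t_c))_{c\le m}$, of the map $g$ that takes the real and imaginary parts of the values of $\hat\phi_n$ at $t_1,\dots,t_m$ to $(\hat\alpha^{mult},\hat\Sigma_d,\hat\Sigma_{nd})$ (and $g$ is differentiable there). Explicitly, the entry of $G$ in row $r$ and the column of $\operatorname{Re}\phi(t_c)$, respectively of $\operatorname{Im}\phi(t_c)$,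 is $\tilde G_{r,c}\operatorname{Re}\phi(t_c)/|\phi(t_c)|$, respectively $\tilde G_{r,c}\operatorname{Im}\phi(t_c)/|\phi(t_c)|$. Here, with $\ell(t)=\log|\phi(t)|\cdot|\phi(t)|$, $q^\pm_{ij}=\frac12\Sigma_{ii}\pm\Sigma_{ij}+\frac12\Sigma_{jj}$ and $0\log 0=0$, the entries of $\tilde G$ are, by row: - row $\alpha$: $\;\dfrac{1}{pL\,\ell(s_1e_k)}$ in column $s_1e_k$, $\;-\dfrac{1}{pL\,\ell(s_2e_k)}$ in column $s_2e_k$, and $0$ in the other columns; - row $\Sigma_{jj}$: $\;\dfrac{-\Sigma_{jj}\log(\frac{s_1^2}{2}\Sigma_{jj})}{\alpha pL\,\ell(s_1e_k)}$ in column $s_1e_k$, $k\ne j$; $\;\dfrac{2\Sigma_{jj}}{\alpha\,\ell(s_1e_j)}\Bigl(1-\dfrac{\log(\frac{s_1^2}{2}\Sigma_{jj})}{2pL}\Bigr)$ in column $s_1e_j$; $\;\dfrac{\Sigma_{jj}\log(\frac{s_1^2}{2}\Sigma_{jj})}{\alpha pL\,\ell(s_2e_k)}$ in column $s_2e_k$;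 and $0$ in the other columns; - row $\Sigma_{ij}$, $j<i$: $\;\dfrac{D_{ij}}{\ell(s_1e_k)}$ in column $s_1e_k$ and $-\dfrac{D_{ij}}{\ell(s_2e_k)}$ in column $s_2e_k$, where $D_{ij}=-\dfrac{q^+_{ij}\log q^+_{ij}-q^-_{ij}\log q^-_{ij}}{2\alpha pL}$; $\;-\dfrac{(q^+_{ij})^{1-\alpha/2}}{\alpha|\phi(e_i+e_j)|}$ in column $e_i+e_j$; $\;\dfrac{(q^-_{ij})^{1-\alpha/2}}{\alpha|\phi(e_i-e_j)|}$ in column $e_i-e_j$; and $0$ in the other columns. -/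

import Mathlib

open MeasureTheory ProbabilityTheory Filter Topology
open scoped Matrix

namespace SubGaussianStable

noncomputable section

/-- The `k`-th standard basis vector of `ℝ^p`. -/
def e {p : ℕ} (k : Fin p) : EuclideanSpace ℝ (Fin p) := EuclideanSpace.single k 1

/-- The function `φ(t) = exp (i tᵀμ - (tᵀ S t / 2) ^ (α / 2))`. -/
def stableCharFun {p : ℕ} (μ : EuclideanSpace ℝ (Fin p)) (S : Matrix (Fin p) (Fin p) ℝ) (α : ℝ)
    (t : EuclideanSpace ℝ (Fin p)) : ℂ :=
  Complex.exp (Complex.I * ((inner ℝ t μ : ℝ) : ℂ)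
    - (((1 / 2 * (t.ofLp ⬝ᵥ (S *ᵥ t.ofLp))) ^ (α / 2) : ℝ) : ℂ))

/-- `ν` is the sub-Gaussian stable law `S_p(μ, S, α)`. -/
def IsSubGaussianStable {p : ℕ} (ν : Measure (EuclideanSpace ℝ (Fin p)))
    (μ : EuclideanSpace ℝ (Fin p)) (S : Matrix (Fin p) (Fin p) ℝ) (α : ℝ) : Prop :=
  ∀ t, charFun ν t = stableCharFun μ S α t

/-- The empirical characteristic function of the sample `x 0, …, x (n - 1)`. -/
def ecf {p : ℕ} (n : ℕ) (x : ℕ → EuclideanSpace ℝ (Fin p)) (t : EuclideanSpace ℝ (Fin p)) : ℂ :=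
  1 / (n : ℂ) * ∑ j ∈ Finset.range n, Complex.exp (Complex.I * ((inner ℝ t (x j) : ℝ) : ℂ))

/-! ### Index sets -/

/-- The positions `(i, j)` with `j < i` below the diagonal of a `p × p` matrix. -/
abbrev LowerPair (p : ℕ) : Type := (i : Fin p) × Fin (i : ℕ)

/-- The row index `i` of `(i, j)`. -/
def LowerPair.row {p : ℕ} (q : LowerPair p) : Fin p := q.1

/-- The column index `j` of `(i, j)`. -/
def LowerPair.col {p : ℕ} (q : LowerPair p) : Fin p := ⟨q.2, q.2.isLt.trans q.1.isLt⟩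

/-- Coordinates of the vector `(α, S_d, S_nd)`. -/
abbrev ParamIdx (p : ℕ) : Type := Unit ⊕ Fin p ⊕ LowerPair p

/-- Labels of the `p² + p` points `s₁ e_k`, `s₂ e_k`, `e_i + e_j`, `e_i - e_j`, in this order. -/
abbrev GridIdx (p : ℕ) : Type := Fin p ⊕ Fin p ⊕ LowerPair p ⊕ LowerPair p

/-- Coordinates of the vector of all real parts followed by all imaginary parts. -/
abbrev CoordIdx (p : ℕ) : Type := GridIdx p ⊕ GridIdx p

/-- The number of coordinates of `(α, S_d, S_nd)` is `p (p + 1) / 2 + 1`. -/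
theorem card_paramIdx (p : ℕ) : Fintype.card (ParamIdx p) = p * (p + 1) / 2 + 1 := by
  have h : ∑ i : Fin p, (i : ℕ) = p * (p - 1) / 2 := by
    rw [Fin.sum_univ_eq_sum_range (fun i => i) p, Finset.sum_range_id]
  simp only [Fintype.card_sum, Fintype.card_unit, Fintype.card_fin, Fintype.card_sigma, h]
  have h2 : p * (p + 1) = p * (p - 1) + p * 2 := by
    cases p with
    | zero => rfl
    | succ m => simp only [Nat.add_sub_cancel]; ring
  rw [h2, Nat.add_mul_div_right _ _ (by norm_num : 0 < 2)]
  omega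

/-- The row-by-row numbering of the positions below the diagonal. With zero-based `i` and `j` it
sends `(i, j)` to `i (i - 1) / 2 + j`. -/
theorem lowerPair_number {p : ℕ} (q : LowerPair p) :
    (finSigmaFinEquiv (n := fun i : Fin p => (i : ℕ)) q : ℕ)
      = (q.row : ℕ) * ((q.row : ℕ) - 1) / 2 + (q.col : ℕ) := by
  rw [finSigmaFinEquiv_apply]
  simp only [LowerPair.row, LowerPair.col, Fin.val_castLE]
  rw [Fin.sum_univ_eq_sum_range (fun i => i) _, Finset.sum_range_id]

/-! ### The estimators -/

/-- `α̂_s(k)`, from the values `z₁`, `z₂` of the empirical characteristic function at `s₁ e_k` and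
`s₂ e_k`. -/
def alphaS (s₁ s₂ : ℝ) (z₁ z₂ : ℂ) : ℝ :=
  Real.log (Real.log ‖z₁‖ / Real.log ‖z₂‖) / Real.log |s₁ / s₂|

/-- The diagonal estimator, from the value `z` of the empirical characteristic function at
`s₁ e_i` and an estimate `a` of `α`. -/
def sigmaDiag (s₁ a : ℝ) (z : ℂ) : ℝ := 2 / s₁ ^ 2 * (-Real.log ‖z‖) ^ (2 / a)

/-- The off-diagonal estimator, from the values `z₁`, `z₂` of the empirical characteristic
function at `e_i + e_j` and `e_i - e_j` and an estimate `a` of `α`. -/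
def sigmaOff (a : ℝ) (z₁ z₂ : ℂ) : ℝ :=
  ((-Real.log ‖z₁‖) ^ (2 / a) - (-Real.log ‖z₂‖) ^ (2 / a)) / 2

/-- The points `s₁ e_k`, `s₂ e_k`, `e_i + e_j`, `e_i - e_j`. -/
def gridPt {p : ℕ} (s₁ s₂ : ℝ) : GridIdx p → EuclideanSpace ℝ (Fin p)
  | .inl k => s₁ • e k
  | .inr (.inl k) => s₂ • e k
  | .inr (.inr (.inl q)) => e q.row + e q.col
  | .inr (.inr (.inr q)) => e q.row - e q.col

/-- `α̂^mult`, from the values `z` at the grid points. -/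
def alphaMult {p : ℕ} (s₁ s₂ : ℝ) (z : GridIdx p → ℂ) : ℝ :=
  1 / (p : ℝ) * ∑ k : Fin p, alphaS s₁ s₂ (z (.inl k)) (z (.inr (.inl k)))

/-- The vector `(α̂^mult, Ŝ_d, Ŝ_nd)`, from the values `z` at the grid points. -/
def estimate {p : ℕ} (s₁ s₂ : ℝ) (z : GridIdx p → ℂ) : ParamIdx p → ℝ
  | .inl _ => alphaMult s₁ s₂ z
  | .inr (.inl j) => sigmaDiag s₁ (alphaMult s₁ s₂ z) (z (.inl j))
  | .inr (.inr q) =>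
      sigmaOff (alphaMult s₁ s₂ z) (z (.inr (.inr (.inl q)))) (z (.inr (.inr (.inr q))))

/-- The estimator `(α̂^mult, Ŝ_d, Ŝ_nd)` computed from the sample `x 0, …, x (n - 1)`. -/
def estimator {p : ℕ} (s₁ s₂ : ℝ) (n : ℕ) (x : ℕ → EuclideanSpace ℝ (Fin p)) : ParamIdx p → ℝ :=
  estimate s₁ s₂ (fun c => ecf n x (gridPt s₁ s₂ c))

/-- The vector `(α, S_d, S_nd)` of true parameters. -/
def params {p : ℕ} (α : ℝ) (S : Matrix (Fin p) (Fin p) ℝ) : ParamIdx p → ℝ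
  | .inl _ => α
  | .inr (.inl j) => S j j
  | .inr (.inr q) => S q.row q.col

/-- The vector of all real parts followed by all imaginary parts. -/
def reIm {ι : Type*} (z : ι → ℂ) : ι ⊕ ι → ℝ :=
  Sum.elim (fun c => (z c).re) (fun c => (z c).im)

/-- The map `g` that sends the real and imaginary parts of the values at the grid points to
`(α̂^mult, Ŝ_d, Ŝ_nd)`. -/
def estMap {p : ℕ} (s₁ s₂ : ℝ) (θ : CoordIdx p → ℝ) : ParamIdx p → ℝ :=
  estimate s₁ s₂ (fun c => (⟨θ (.inl c), θ (.inr c)⟩ : ℂ))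

/-! ### The matrix `Ω` -/

/-- The block matrix `Ω` for the characteristic function `φ` and the points `t`. -/
def Omega {ι E : Type*} [AddGroup E] (φ : E → ℂ) (t : ι → E) : Matrix (ι ⊕ ι) (ι ⊕ ι) ℝ :=
  let ΩRe : Matrix ι ι ℝ := Matrix.of fun j k =>
    1 / 2 * (φ (t j + t k)).re + 1 / 2 * (φ (t k - t j)).re - (φ (t j)).re * (φ (t k)).re
  let ΩIm : Matrix ι ι ℝ := Matrix.of fun j k =>
    -(1 / 2 * (φ (t j + t k)).re) + 1 / 2 * (φ (t k - t j)).re - (φ (t j)).im * (φ (t k)).im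
  let ΩRI : Matrix ι ι ℝ := Matrix.of fun j k =>
    1 / 2 * (φ (t j + t k)).im + 1 / 2 * (φ (t k - t j)).im - (φ (t j)).re * (φ (t k)).im
  Matrix.fromBlocks ΩRe ΩRI ΩRIᵀ ΩIm

/-! ### The Jacobian `G` -/

section Jacobian

variable {p : ℕ} (μ : EuclideanSpace ℝ (Fin p)) (S : Matrix (Fin p) (Fin p) ℝ) (α s₁ s₂ : ℝ)

/-- `log |φ(t)| · |φ(t)|`. -/
def logMod (t : EuclideanSpace ℝ (Fin p)) : ℝ :=
  Real.log ‖stableCharFun μ S α t‖ * ‖stableCharFun μ S α t‖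

/-- `S_ii / 2 + S_ij + S_jj / 2`. -/
def qPlus (q : LowerPair p) : ℝ := 1 / 2 * S q.row q.row + S q.row q.col + 1 / 2 * S q.col q.col

/-- `S_ii / 2 - S_ij + S_jj / 2`. -/
def qMinus (q : LowerPair p) : ℝ := 1 / 2 * S q.row q.row - S q.row q.col + 1 / 2 * S q.col q.col

/-- Derivative of `α̂^mult` with respect to `|φ(s₁ e_k)|`. -/
def coefA₁ (k : Fin p) : ℝ := ((p : ℝ) * Real.log |s₁ / s₂| * logMod μ S α (s₁ • e k))⁻¹

/-- Derivative of `α̂^mult` with respect to `|φ(s₂ e_k)|`. -/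
def coefA₂ (k : Fin p) : ℝ := -((p : ℝ) * Real.log |s₁ / s₂| * logMod μ S α (s₂ • e k))⁻¹

/-- Derivative of `Ŝ_jj` with respect to `|φ(s₁ e_k)|`, for `k ≠ j`. -/
def coefB₁ (j k : Fin p) : ℝ :=
  -S j j * Real.log (s₁ ^ 2 / 2 * S j j) /
    (α * p * Real.log |s₁ / s₂| * logMod μ S α (s₁ • e k))

/-- Derivative of `Ŝ_jj` with respect to `|φ(s₁ e_j)|`. -/
def coefBd (j : Fin p) : ℝ :=
  2 * S j j / (α * logMod μ S α (s₁ • e j)) *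
    (1 - Real.log (s₁ ^ 2 * S j j / 2) / (2 * p * Real.log |s₁ / s₂|))

/-- Derivative of `Ŝ_jj` with respect to `|φ(s₂ e_k)|`. -/
def coefB₂ (j k : Fin p) : ℝ :=
  S j j * Real.log (s₁ ^ 2 / 2 * S j j) /
    (α * p * Real.log |s₁ / s₂| * logMod μ S α (s₂ • e k))

/-- The common factor of the derivatives of `Ŝ_ij` with respect to `|φ(s₁ e_k)|`, `|φ(s₂ e_k)|`
(where `0 · log 0 = 0`). -/
def coefD (q : LowerPair p) : ℝ :=
  -(qPlus S q * Real.log (qPlus S q) - qMinus S q * Real.log (qMinus S q)) /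
    (2 * α * p * Real.log |s₁ / s₂|)

/-- Derivative of `Ŝ_ij` with respect to `|φ(e_i + e_j)|`. -/
def dPlus (q : LowerPair p) : ℝ :=
  -(1 / (α * ‖stableCharFun μ S α (e q.row + e q.col)‖)) * qPlus S q ^ (1 - α / 2)

/-- Derivative of `Ŝ_ij` with respect to `|φ(e_i - e_j)|`. -/
def dMinus (q : LowerPair p) : ℝ :=
  1 / (α * ‖stableCharFun μ S α (e q.row - e q.col)‖) * qMinus S q ^ (1 - α / 2)

/-- The derivatives of the estimators with respect to the moduli `|φ(t)|` at the grid points. -/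
def jacAbs : ParamIdx p → GridIdx p → ℝ
  | .inl _, .inl k => coefA₁ μ S α s₁ s₂ k
  | .inl _, .inr (.inl k) => coefA₂ μ S α s₁ s₂ k
  | .inl _, .inr (.inr _) => 0
  | .inr (.inl j), .inl k => if j = k then coefBd μ S α s₁ s₂ j else coefB₁ μ S α s₁ s₂ j k
  | .inr (.inl j), .inr (.inl k) => coefB₂ μ S α s₁ s₂ j k
  | .inr (.inl _), .inr (.inr _) => 0
  | .inr (.inr q), .inl k => coefD S α s₁ s₂ q / logMod μ S α (s₁ • e k)
  | .inr (.inr q), .inr (.inl k) => -coefD S α s₁ s₂ q / logMod μ S α (s₂ • e k)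
  | .inr (.inr q), .inr (.inr (.inl q')) => if q = q' then dPlus μ S α q else 0
  | .inr (.inr q), .inr (.inr (.inr q')) => if q = q' then dMinus μ S α q else 0

/-- The `(p (p + 1) / 2 + 1) × 2 (p² + p)` matrix `G`. -/
def jacobian : Matrix (ParamIdx p) (CoordIdx p) ℝ :=
  Matrix.of fun r => Sum.elim
    (fun c => jacAbs μ S α s₁ s₂ r c *
      ((stableCharFun μ S α (gridPt s₁ s₂ c)).re / ‖stableCharFun μ S α (gridPt s₁ s₂ c)‖))
    (fun c => jacAbs μ S α s₁ s₂ r c *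
      ((stableCharFun μ S α (gridPt s₁ s₂ c)).im / ‖stableCharFun μ S α (gridPt s₁ s₂ c)‖))

end Jacobian

end

end SubGaussianStable

open SubGaussianStable

/-! The estimator is a fixed function `estMap` of finitely many empirical means of bounded
variables, the cosines and sines of `tᵀx` at the grid points. The multivariate central limit theorem
gives these means a Gaussian limit with covariance `Omega`, and the delta method carries the limit
through `estMap`. Two facts about the model remain: `estMap` returns the true parameters at the true
values (`estimate_stableCharFun`), and it is differentiable there with matrix `jacobian`
(`hasFDerivAt_estMap`).

Both rest on the identity `-log |φ(t)| = q ^ (α/2)`, with `q` half the quadratic form of `S` at `t`: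
the modulus removes the location `μ`, a ratio of logarithms along one axis isolates `α`, and the
power `2/α` recovers `q`. Polarization of `q` at `e_i ± e_j` gives the off-diagonal entries.

The delicate point is that `S` may be singular, so that `q` can vanish at `e_i + e_j` or `e_i -
e_j`. There `x ^ (2/a)` is evaluated at base `0`, and it is still differentiable because `2/α > 1`;
this is where `α < 2` enters (`hasFDerivAt_rpow_two_div`). On the axes `q > 0`, so the logarithms of
`-log |φ|` are smooth. -/

/-! ### The delta method -/

/-- A sequence converging in law is bounded in probability, so `T n` lies within `O(1/√n)` of `θ` up
to small probability, and there the linearization error is `o(1/√n)`. -/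
theorem tendstoInMeasure_delta_remainder {Ω Ω' E F : Type*} [MeasurableSpace Ω]
    [MeasurableSpace Ω'] {P : Measure Ω} [IsProbabilityMeasure P] {P' : Measure Ω'}
    [IsProbabilityMeasure P']
    [NormedAddCommGroup E] [NormedSpace ℝ E] [MeasurableSpace E] [BorelSpace E]
    [NormedAddCommGroup F] [NormedSpace ℝ F]
    {g : E → F} {L : E →L[ℝ] F} {θ : E} (hg : HasFDerivAt g L θ)
    {T : ℕ → Ω → E} {Z : Ω' → E}
    (hT : TendstoInDistribution (fun (n : ℕ) ω => √(n : ℝ) • (T n ω - θ)) atTop Z (fun _ => P) P') :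
    TendstoInMeasure P
      ((fun (n : ℕ) ω => √(n : ℝ) • (g (T n ω) - g θ)) -
        (fun (n : ℕ) ω => L (√(n : ℝ) • (T n ω - θ)))) atTop 0 := by
  rw [tendstoInMeasure_iff_norm]
  intro ε hε
  rw [ENNReal.tendsto_nhds_zero]
  intro δ hδ
  let A : ℕ → Set E := fun M => {z | (M : ℝ) ≤ ‖z‖}
  have hAc : ∀ M, IsClosed (A M) := fun M => isClosed_le continuous_const continuous_norm
  have hprob : IsProbabilityMeasure (P'.map Z) :=
    Measure.isProbabilityMeasure_map hT.aemeasurable_limit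
  have hlim : Tendsto (fun M => P'.map Z (A M)) atTop (𝓝 0) := by
    have h0 : ⋂ M, A M = ∅ := by
      ext z
      simp only [A, Set.mem_iInter, Set.mem_ofPred_eq, Set.mem_empty_iff_false, iff_false, not_forall,
        not_le]
      exact exists_nat_gt _
    have := tendsto_measure_iInter_atTop (μ := P'.map Z) (s := A)
      (fun M => (hAc M).measurableSet.nullMeasurableSet)
      (fun a b hab z hz => (Nat.cast_le.2 hab : (a : ℝ) ≤ b).trans hz) ⟨0, measure_ne_top _ _⟩
    rwa [h0, measure_empty] at this
  -- The limit law gives mass less than `δ` to norms of at least `M`. The set is closed, so the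
  -- portmanteau theorem passes this bound to all large `n`.
  obtain ⟨M, hMδ, hM0⟩ := ((hlim.eventually_lt_const hδ).and (eventually_gt_atTop 0)).exists
  have hM : (0 : ℝ) < M := by exact_mod_cast hM0
  have hev : ∀ᶠ n : ℕ in atTop, P {ω | (M : ℝ) ≤ ‖√(n : ℝ) • (T n ω - θ)‖} < δ := by
    have h1 := ProbabilityMeasure.limsup_measure_closed_le_of_tendsto hT.tendsto (hAc M)
    have h2 := eventually_lt_of_limsup_lt (lt_of_le_of_lt h1 hMδ)
    filter_upwards [h2] with n hn
    rw [ProbabilityMeasure.coe_mk,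
      Measure.map_apply_of_aemeasurable (hT.forall_aemeasurable n) (hAc M).measurableSet] at hn
    exact hn
  -- With this slope the rescaled remainder is at most `ε / (2M) * M = ε / 2` wherever the rescaled
  -- error is below `M`.
  have hη : (0 : ℝ) < ε / (2 * M) := by positivity
  obtain ⟨η, hη0, hball⟩ := Metric.eventually_nhds_iff.1
    ((Asymptotics.isLittleO_iff.1 hg.isLittleO) hη)
  have hsq : Tendsto (fun n : ℕ => √(n : ℝ)) atTop atTop :=
    Real.tendsto_sqrt_atTop.comp tendsto_natCast_atTop_atTop
  filter_upwards [hev, hsq.eventually_gt_atTop (M / η), hsq.eventually_gt_atTop 0] with n hn hn2 hn3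
  refine (measure_mono ?_).trans hn.le
  intro ω hω
  simp only [Set.mem_ofPred_eq, Pi.sub_apply, Pi.zero_apply, sub_zero] at hω ⊢
  by_contra! hlt
  rw [norm_smul, Real.norm_of_nonneg hn3.le] at hlt
  have hclose : dist (T n ω) θ < η := by
    rw [dist_eq_norm]
    rw [div_lt_iff₀ hη0] at hn2
    by_contra! h
    nlinarith
  have hb := hball hclose
  rw [map_smul, ← smul_sub, norm_smul, Real.norm_of_nonneg hn3.le] at hω
  have h3 : ε ≤ ε / (2 * M) * M := by
    calc ε ≤ √(n : ℝ) * (ε / (2 * M) * ‖T n ω - θ‖) :=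
          hω.trans (mul_le_mul_of_nonneg_left hb hn3.le)
      _ = ε / (2 * M) * (√(n : ℝ) * ‖T n ω - θ‖) := by ring
      _ ≤ _ := by gcongr
  have h4 : ε / (2 * M) * M = ε / 2 := by field_simp
  linarith

/-- The **delta method**. -/
theorem TendstoInDistribution.delta_method {Ω Ω' E F : Type*} [MeasurableSpace Ω]
    [MeasurableSpace Ω'] {P : Measure Ω} [IsProbabilityMeasure P] {P' : Measure Ω'}
    [IsProbabilityMeasure P']
    [NormedAddCommGroup E] [NormedSpace ℝ E] [MeasurableSpace E] [BorelSpace E]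
    [NormedAddCommGroup F] [NormedSpace ℝ F] [MeasurableSpace F] [BorelSpace F]
    [SecondCountableTopology F]
    {g : E → F} {L : E →L[ℝ] F} {θ : E} (hg : HasFDerivAt g L θ)
    {T : ℕ → Ω → E} {Z : Ω' → E}
    (hT : TendstoInDistribution (fun (n : ℕ) ω => √(n : ℝ) • (T n ω - θ)) atTop Z (fun _ => P) P')
    (hgT : ∀ n, AEMeasurable (fun ω => g (T n ω)) P) :
    TendstoInDistribution (fun (n : ℕ) ω => √(n : ℝ) • (g (T n ω) - g θ)) atTop (L ∘ Z)
      (fun _ => P) P' :=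
  tendstoInDistribution_of_tendstoInMeasure_sub _ _ (hT.continuous_comp L.continuous)
    (tendstoInMeasure_delta_remainder hg hT)
    fun n => ((hgT n).sub_const _).const_smul _

/-- Only the law of the limit variable matters; this lets a linear image of a Gaussian vector be
replaced by the identity under the image law. -/
theorem TendstoInDistribution.of_map_eq {ι E Ω' Ω'' : Type*} {Ω : ι → Type*}
    [∀ i, MeasurableSpace (Ω i)] {P : ∀ i, Measure (Ω i)} [∀ i, IsProbabilityMeasure (P i)]
    [MeasurableSpace Ω'] {P' : Measure Ω'} [IsProbabilityMeasure P']
    [MeasurableSpace Ω''] {P'' : Measure Ω''} [IsProbabilityMeasure P'']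
    [TopologicalSpace E] [MeasurableSpace E] [OpensMeasurableSpace E]
    {T : ∀ i, Ω i → E} {l : Filter ι} {Z : Ω' → E} {W : Ω'' → E}
    (h : TendstoInDistribution T l Z P P') (hW : AEMeasurable W P'')
    (heq : P'.map Z = P''.map W) : TendstoInDistribution T l W P P'' := by
  refine ⟨h.forall_aemeasurable, hW, ?_⟩
  have hlaw : (⟨P'.map Z, Measure.isProbabilityMeasure_map h.aemeasurable_limit⟩ :
      ProbabilityMeasure E) = ⟨P''.map W, Measure.isProbabilityMeasure_map hW⟩ := Subtype.ext heq
  exact hlaw ▸ h.tendsto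

/-! ### Covariance matrices, the multivariate central limit theorem, Gaussian images -/

section Cov

variable {ι Ω : Type*} [Fintype ι] [MeasurableSpace Ω] {P : Measure Ω} [IsProbabilityMeasure P]

theorem variance_sum_mul_eq_dotProduct {Y : Ω → ι → ℝ} (hY : ∀ a, MemLp (fun ω => Y ω a) 2 P)
    {C : Matrix ι ι ℝ} (hC : ∀ a b, C a b = cov[fun ω => Y ω a, fun ω => Y ω b; P]) (u : ι → ℝ) :
    Var[fun ω => ∑ a, u a * Y ω a; P] = u ⬝ᵥ (C *ᵥ u) := by
  rw [variance_fun_sum (fun a => (hY a).const_mul (u a))]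
  simp only [dotProduct, Matrix.mulVec, Finset.mul_sum]
  refine Finset.sum_congr rfl fun a _ => Finset.sum_congr rfl fun b _ => ?_
  rw [covariance_const_mul_left, covariance_const_mul_right, hC]
  ring

theorem posSemidef_of_eq_covariance {Y : Ω → ι → ℝ} (hY : ∀ a, MemLp (fun ω => Y ω a) 2 P)
    {C : Matrix ι ι ℝ} (hC : ∀ a b, C a b = cov[fun ω => Y ω a, fun ω => Y ω b; P]) :
    C.PosSemidef := by
  refine Matrix.PosSemidef.of_dotProduct_mulVec_nonneg ?_ fun u => ?_
  · ext a b
    simp [hC, covariance_comm]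
  · rw [star_trivial, ← variance_sum_mul_eq_dotProduct hY hC]
    exact variance_nonneg _ _

/-- The **multivariate central limit theorem**. -/
theorem tendstoInDistribution_multivariateGaussian [DecidableEq ι]
    {Y : ℕ → Ω → EuclideanSpace ℝ ι} (hYm : ∀ n, Measurable (Y n))
    (hY : ∀ a, MemLp (fun ω => Y 0 ω a) 2 P)
    (hindep : iIndepFun Y P) (hident : ∀ i, IdentDistrib (Y i) (Y 0) P P)
    {C : Matrix ι ι ℝ} (hC : ∀ a b, C a b = cov[fun ω => Y 0 ω a, fun ω => Y 0 ω b; P])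
    {m : EuclideanSpace ℝ ι} (hm : ∀ a, m a = ∫ ω, Y 0 ω a ∂P) :
    TendstoInDistribution
      (fun (n : ℕ) ω => (√(n : ℝ))⁻¹ • (∑ k ∈ Finset.range n, Y k ω - (n : ℝ) • m)) atTop id
      (fun _ => P) (multivariateGaussian 0 C) where
  forall_aemeasurable n := by
    have := hYm
    exact Measurable.aemeasurable (by fun_prop)
  tendsto := by
    refine ProbabilityMeasure.tendsto_iff_tendsto_charFun.2 fun t => ?_
    have hinner : ∀ (y : EuclideanSpace ℝ ι), inner ℝ y t = ∑ a, t a * y a := by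
      intro y
      simp [PiLp.inner_apply]
    -- Cramér–Wold: the characteristic function of the vector at `t` is that of its projection on
    -- `t` at `1`, so the scalar theorem suffices.
    have hclt := tendstoInDistribution_inv_sqrt_mul_sum_sub (P := P)
      (X := fun k ω => inner ℝ (Y k ω) t)
      (P' := gaussianReal 0 (Var[fun ω => inner ℝ (Y 0 ω) t; P]).toNNReal) (Y := id)
      HasLaw.id ?_ ?_ ?_
    · have h1 := ProbabilityMeasure.tendsto_iff_tendsto_charFun.1 hclt.tendsto 1
      have hmean : ∫ ω, inner ℝ (Y 0 ω) t ∂P = inner ℝ m t := by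
        simp only [hinner]
        rw [integral_finsetSum _
          fun a _ => ((hY a).integrable (by norm_num)).const_mul _]
        simp [integral_const_mul, hm]
      have hCpos := posSemidef_of_eq_covariance hY hC
      have hvar := variance_sum_mul_eq_dotProduct hY hC t.ofLp
      simp only [ProbabilityMeasure.coe_mk, Measure.map_id] at h1 ⊢
      rw [charFun_multivariateGaussian hCpos]
      rw [charFun_gaussianReal] at h1
      convert h1 using 1
      · ext n
        rw [charFun_apply, charFun_apply, integral_map, integral_map]
        · simp only [inner_smul_left, inner_sub_left, sum_inner, hmean]
          simp
        · exact hclt.forall_aemeasurable n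
        · fun_prop
        · have := hYm
          exact Measurable.aemeasurable (by fun_prop)
        · fun_prop
      · congr 2
        simp only [hinner, hvar]
        have : 0 ≤ t.ofLp ⬝ᵥ (C *ᵥ t.ofLp) := by
          simpa using hCpos.dotProduct_mulVec_nonneg t.ofLp
        rw [Real.coe_toNNReal _ this]
        simp
    · simp only [hinner]
      exact memLp_finsetSum _ fun a _ => (hY a).const_mul _
    · exact hindep.comp (fun _ y => inner ℝ y t) fun _ => by fun_prop
    · exact fun i => (hident i).comp (u := fun y => inner ℝ y t) (by fun_prop)

end Cov

/-- Characteristic functions agree because `⟨G z, t⟩ = ⟨z, Gᵀ t⟩`; no invertibility is involved, so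
degenerate covariances are covered. -/
theorem map_multivariateGaussian_mulVec {ι κ : Type*} [Fintype ι] [DecidableEq ι] [Fintype κ]
    [DecidableEq κ] {C : Matrix ι ι ℝ} (hC : C.PosSemidef) (G : Matrix κ ι ℝ) :
    (multivariateGaussian 0 C).map (fun z => WithLp.toLp 2 (G *ᵥ z.ofLp)) =
      multivariateGaussian (0 : EuclideanSpace ℝ κ) (G * C * Gᵀ) := by
  have hcont : Continuous fun z : EuclideanSpace ℝ ι =>
      (WithLp.toLp 2 (G *ᵥ z.ofLp) : EuclideanSpace ℝ κ) := by fun_prop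
  have hpos : (G * C * Gᵀ).PosSemidef := by
    simpa using hC.mul_mul_conjTranspose_same G
  have : IsProbabilityMeasure ((multivariateGaussian 0 C).map
      (fun z : EuclideanSpace ℝ ι => (WithLp.toLp 2 (G *ᵥ z.ofLp) : EuclideanSpace ℝ κ))) :=
    Measure.isProbabilityMeasure_map hcont.aemeasurable
  refine Measure.ext_of_charFun (funext fun t => ?_)
  rw [charFun_multivariateGaussian hpos, charFun_apply, integral_map hcont.aemeasurable (by fun_prop)]
  have hin : ∀ z : EuclideanSpace ℝ ι,
      inner ℝ (WithLp.toLp 2 (G *ᵥ z.ofLp) : EuclideanSpace ℝ κ) t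
        = inner ℝ z (WithLp.toLp 2 (Gᵀ *ᵥ t.ofLp)) := by
    intro z
    simp only [EuclideanSpace.inner_eq_star_dotProduct, star_trivial]
    rw [Matrix.dotProduct_mulVec, Matrix.mulVec_transpose]
  simp only [hin]
  rw [← charFun_apply, charFun_multivariateGaussian hC]
  simp only [inner_zero_right]
  congr 4
  rw [← Matrix.mulVec_mulVec, ← Matrix.mulVec_mulVec, Matrix.dotProduct_mulVec (t.ofLp) G,
    Matrix.mulVec_transpose]

/-! ### Differentiability of the power `x ^ (2 / a)` and of the modulus -/

/-- The map `(x, a) ↦ x ^ (2 / a)` is differentiable at `(q ^ (α / 2), α)`, also for `q = 0`. -/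
theorem hasFDerivAt_rpow_two_div {E : Type*} [NormedAddCommGroup E] [NormedSpace ℝ E]
    {f a : E → ℝ} {f' a' : E →L[ℝ] ℝ} {x : E} {q α : ℝ} (hq : 0 ≤ q) (hα0 : 0 < α) (hα2 : α < 2)
    (hf : HasFDerivAt f f' x) (ha : HasFDerivAt a a' x) (hfx : f x = q ^ (α / 2)) (hax : a x = α) :
    HasFDerivAt (fun y => f y ^ (2 / a y))
      ((2 / α * q ^ (1 - α / 2)) • f' - (q * Real.log q / α) • a') x := by
  have hd : HasFDerivAt (fun y => 2 / a y) ((-(2 / α ^ 2)) • a') x := by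
    have hne : a x ≠ 0 := by rw [hax]; exact hα0.ne'
    have h := ((hasDerivAt_inv hne).comp_hasFDerivAt x ha).const_mul 2
    refine (h.congr_fderiv ?_).congr_of_eventuallyEq (.of_forall fun y => div_eq_mul_inv _ _)
    rw [hax, smul_smul]
    congr 1
    ring
  rcases hq.eq_or_lt with rfl | hq
  · have h0 : f x = 0 := by rw [hfx, Real.zero_rpow (by positivity)]
    -- At `q = 0` the claimed derivative is zero: `1 - α / 2` is not `0`, and `0 * log 0 = 0`.
    have hder : (2 / α * (0 : ℝ) ^ (1 - α / 2)) • f' - (0 * Real.log 0 / α) • a' = 0 := by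
      rw [Real.zero_rpow (by linarith)]
      simp
    rw [hder]
    -- An exponent `c > 1` that stays below `2 / a y` near `x`: then `|f| ^ (2 / a) ≤ |f| ^ c`, and
    -- `|f| ^ c = |f| ^ (c - 1) * |f|` is `o(1) * O(y - x)`.
    obtain ⟨c, hc1, hc2⟩ := exists_between ((one_lt_div hα0).2 hα2)
    have hev : ∀ᶠ y in 𝓝 x, c < 2 / a y :=
      hd.continuousAt.tendsto.eventually (lt_mem_nhds (by simpa only [hax] using hc2))
    have hsmall : ∀ᶠ y in 𝓝 x, |f y| < 1 := by
      exact hf.continuousAt.abs.tendsto.eventually (gt_mem_nhds (by simp [h0]))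
    have hcpow : (fun y => |f y| ^ c) =o[𝓝 x] fun y => y - x := by
      have h1 : (fun y => |f y|) =O[𝓝 x] fun y => y - x := by
        simpa [h0] using hf.isBigO_sub.abs_left
      have h2 : (fun y => |f y| ^ (c - 1)) =o[𝓝 x] fun _ => (1 : ℝ) := by
        rw [Asymptotics.isLittleO_one_iff]
        have h3 : Tendsto (fun y => |f y|) (𝓝 x) (𝓝 0) := by
          simpa [h0] using hf.continuousAt.abs.tendsto
        have h4 := h3.rpow_const (p := c - 1) (Or.inr (by linarith))
        rwa [Real.zero_rpow (by linarith)] at h4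
      have h5 := h2.mul_isBigO h1.norm_right
      refine (h5.congr (fun y => ?_) fun y => one_mul _).of_norm_right
      conv_rhs => rw [show c = (c - 1) + 1 by ring]
      rw [Real.rpow_add_one' (abs_nonneg _) (by linarith)]
    rw [hasFDerivAt_iff_isLittleO]
    refine Asymptotics.IsBigO.trans_isLittleO ?_ hcpow
    refine Asymptotics.IsBigO.of_bound 1 ?_
    filter_upwards [hev, hsmall] with y hy hy1
    have hx0 : f x ^ (2 / a x) = 0 := by
      rw [h0, hax, Real.zero_rpow (by positivity)]
    rw [hx0, zero_apply, sub_zero, sub_zero, one_mul, Real.norm_eq_abs,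
      Real.norm_of_nonneg (by positivity)]
    -- Near `x` the base `f y` may be negative; the real power is still bounded by the power of `|f
    -- y|`.
    refine (Real.abs_rpow_le_abs_rpow _ _).trans ?_
    rcases (abs_nonneg (f y)).eq_or_lt with h | h
    · rw [← h, Real.zero_rpow (by linarith), Real.zero_rpow (by linarith)]
    · exact Real.rpow_le_rpow_of_exponent_ge h hy1.le hy.le
  · have hpos : 0 < f x := by rw [hfx]; positivity
    refine (hf.rpow hd hpos).congr_fderiv ?_
    rw [hfx, hax, ← Real.rpow_mul hq.le, ← Real.rpow_mul hq.le, Real.log_rpow hq]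
    have e1 : α / 2 * (2 / α - 1) = 1 - α / 2 := by field_simp
    have e2 : α / 2 * (2 / α) = 1 := by field_simp
    rw [e1, e2, Real.rpow_one]
    ext v
    simp
    field_simp
    ring

/-- The derivative of `θ ↦ |θ_c|` at `z`, where `θ` lists real and imaginary parts. -/
noncomputable def modulusDeriv {ι : Type*} [Fintype ι] (z : ι → ℂ) (c : ι) : (ι ⊕ ι → ℝ) →L[ℝ] ℝ :=
  ((z c).re / ‖z c‖) • ContinuousLinearMap.proj (Sum.inl c) +
    ((z c).im / ‖z c‖) • ContinuousLinearMap.proj (Sum.inr c)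

theorem hasFDerivAt_modulus {ι : Type*} [Fintype ι] {z : ι → ℂ} {c : ι} (hz : z c ≠ 0) :
    HasFDerivAt (fun θ : ι ⊕ ι → ℝ => ‖(⟨θ (.inl c), θ (.inr c)⟩ : ℂ)‖) (modulusDeriv z c)
      (reIm z) := by
  have hre : HasFDerivAt (fun θ : ι ⊕ ι → ℝ => θ (.inl c))
      (ContinuousLinearMap.proj (R := ℝ) (φ := fun _ : ι ⊕ ι => ℝ) (Sum.inl c)) (reIm z) :=
    hasFDerivAt_apply _ _
  have him : HasFDerivAt (fun θ : ι ⊕ ι → ℝ => θ (.inr c))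
      (ContinuousLinearMap.proj (R := ℝ) (φ := fun _ : ι ⊕ ι => ℝ) (Sum.inr c)) (reIm z) :=
    hasFDerivAt_apply _ _
  have hn : ‖z c‖ = √((z c).re * (z c).re + (z c).im * (z c).im) := by
    rw [Complex.norm_def, Complex.normSq_apply]
  have hne : (z c).re * (z c).re + (z c).im * (z c).im ≠ 0 := by
    rw [← Complex.normSq_apply]
    exact (Complex.normSq_pos.2 hz).ne'
  have h := ((hre.mul hre).add (him.mul him)).sqrt (x := reIm z) hne
  simp only [Complex.norm_def, Complex.normSq_apply]
  refine h.congr_fderiv ?_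
  ext v
  have hpos : ‖z c‖ ≠ 0 := norm_ne_zero_iff.2 hz
  simp [modulusDeriv, reIm, ← hn]
  field_simp
  ring

/-! ### True values and derivatives of the estimators -/

section Jacobian

variable {p : ℕ} (μ : EuclideanSpace ℝ (Fin p)) (S : Matrix (Fin p) (Fin p) ℝ) (α : ℝ)

/-- The location contributes a purely imaginary exponent, which the modulus removes. -/
theorem norm_stableCharFun (t : EuclideanSpace ℝ (Fin p)) :
    ‖stableCharFun μ S α t‖ = Real.exp (-(1 / 2 * (t.ofLp ⬝ᵥ (S *ᵥ t.ofLp))) ^ (α / 2)) := by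
  rw [stableCharFun, Complex.norm_exp]
  congr 1
  rw [Complex.sub_re, Complex.ofReal_re, Complex.re_mul_ofReal]
  simp

theorem stableCharFun_ne_zero (t : EuclideanSpace ℝ (Fin p)) : stableCharFun μ S α t ≠ 0 :=
  Complex.exp_ne_zero _

theorem neg_log_norm_stableCharFun (t : EuclideanSpace ℝ (Fin p)) :
    -Real.log ‖stableCharFun μ S α t‖ = (1 / 2 * (t.ofLp ⬝ᵥ (S *ᵥ t.ofLp))) ^ (α / 2) := by
  rw [norm_stableCharFun, Real.log_exp, neg_neg]

theorem quadForm_smul_e (s : ℝ) (k : Fin p) :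
    1 / 2 * ((s • e k).ofLp ⬝ᵥ (S *ᵥ (s • e k).ofLp)) = s ^ 2 / 2 * S k k := by
  simp [e, Matrix.mulVec_smul, EuclideanSpace.single]
  ring

variable {S}

theorem quadForm_add (hS : S.PosSemidef) (q : LowerPair p) :
    1 / 2 * ((e q.row + e q.col).ofLp ⬝ᵥ (S *ᵥ (e q.row + e q.col).ofLp)) = qPlus S q := by
  have hs : S q.col q.row = S q.row q.col := by simpa using hS.1.apply q.row q.col
  simp [e, EuclideanSpace.single, Matrix.mulVec_add, qPlus, hs]
  ring

theorem quadForm_sub (hS : S.PosSemidef) (q : LowerPair p) :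
    1 / 2 * ((e q.row - e q.col).ofLp ⬝ᵥ (S *ᵥ (e q.row - e q.col).ofLp)) = qMinus S q := by
  have hs : S q.col q.row = S q.row q.col := by simpa using hS.1.apply q.row q.col
  simp [e, EuclideanSpace.single, Matrix.mulVec_sub, qMinus, hs]
  ring

theorem quadForm_nonneg (hS : S.PosSemidef) (v : Fin p → ℝ) : 0 ≤ 1 / 2 * (v ⬝ᵥ (S *ᵥ v)) := by
  have := hS.dotProduct_mulVec_nonneg v
  rw [star_trivial] at this
  positivity

theorem hasFDerivAt_neg_log_modulus (s₁ s₂ : ℝ) (c : GridIdx p) :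
    HasFDerivAt (fun θ : CoordIdx p → ℝ => -Real.log ‖(⟨θ (.inl c), θ (.inr c)⟩ : ℂ)‖)
      ((-‖stableCharFun μ S α (gridPt s₁ s₂ c)‖⁻¹) •
        modulusDeriv (fun c => stableCharFun μ S α (gridPt s₁ s₂ c)) c)
      (reIm fun c => stableCharFun μ S α (gridPt s₁ s₂ c)) := by
  have hne := stableCharFun_ne_zero μ S α (gridPt s₁ s₂ c)
  have h := ((hasFDerivAt_modulus (z := fun c => stableCharFun μ S α (gridPt s₁ s₂ c)) hne).log
    (norm_ne_zero_iff.2 hne)).neg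
  refine h.congr_fderiv ?_
  exact (neg_smul _ _).symm

theorem neg_log_norm_smul_e (s : ℝ) (k : Fin p) :
    -Real.log ‖stableCharFun μ S α (s • e k)‖ = (s ^ 2 / 2 * S k k) ^ (α / 2) := by
  rw [neg_log_norm_stableCharFun, quadForm_smul_e]

theorem logMod_smul_e (s : ℝ) (k : Fin p) :
    logMod μ S α (s • e k) =
      -((s ^ 2 / 2 * S k k) ^ (α / 2) * ‖stableCharFun μ S α (s • e k)‖) := by
  rw [logMod, ← neg_log_norm_smul_e μ α]
  ring

theorem half_sq_mul_pos (hS : S.PosSemidef) (hSd : ∀ k, S k k ≠ 0) {s : ℝ} (hs : s ≠ 0)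
    (k : Fin p) : 0 < s ^ 2 / 2 * S k k := by
  have h := lt_of_le_of_ne (hS.diag_nonneg (i := k)) (hSd k).symm
  positivity

/-- In the ratio of the two logarithms `S k k` cancels and `|s₁ / s₂| ^ α` remains. -/
theorem alphaS_stableCharFun (hS : S.PosSemidef) (hSd : ∀ k, S k k ≠ 0) {s₁ s₂ : ℝ}
    (hs₁ : s₁ ≠ 0) (hs₂ : s₂ ≠ 0) (hL : Real.log |s₁ / s₂| ≠ 0) (k : Fin p) :
    alphaS s₁ s₂ (stableCharFun μ S α (s₁ • e k)) (stableCharFun μ S α (s₂ • e k)) = α := by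
  have h1 := half_sq_mul_pos hS hSd hs₁ k
  have h2 := half_sq_mul_pos hS hSd hs₂ k
  have hk : S k k ≠ 0 := hSd k
  rw [alphaS, ← neg_div_neg_eq (Real.log ‖_‖), neg_log_norm_smul_e, neg_log_norm_smul_e,
    ← Real.div_rpow h1.le h2.le, Real.log_rpow (by positivity)]
  have h3 : s₁ ^ 2 / 2 * S k k / (s₂ ^ 2 / 2 * S k k) = |s₁ / s₂| ^ 2 := by
    rw [sq_abs]
    field_simp
  rw [h3, Real.log_pow]
  field_simp
  norm_num

theorem alphaMult_stableCharFun (hp : 0 < p) (hS : S.PosSemidef) (hSd : ∀ k, S k k ≠ 0)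
    {s₁ s₂ : ℝ} (hs₁ : s₁ ≠ 0) (hs₂ : s₂ ≠ 0) (hL : Real.log |s₁ / s₂| ≠ 0) :
    alphaMult s₁ s₂ (fun c : GridIdx p => stableCharFun μ S α (gridPt s₁ s₂ c)) = α := by
  have hp' : (p : ℝ) ≠ 0 := by positivity
  simp only [alphaMult, gridPt, alphaS_stableCharFun μ α hS hSd hs₁ hs₂ hL, Finset.sum_const,
    Finset.card_univ, Fintype.card_fin, nsmul_eq_mul]
  field_simp

theorem hasFDerivAt_alphaS (hS : S.PosSemidef) (hSd : ∀ k, S k k ≠ 0)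
    {s₁ s₂ : ℝ} (hs₁ : s₁ ≠ 0) (hs₂ : s₂ ≠ 0) (k : Fin p) :
    HasFDerivAt (fun θ : CoordIdx p → ℝ =>
        alphaS s₁ s₂ ⟨θ (.inl (.inl k)), θ (.inr (.inl k))⟩
          ⟨θ (.inl (.inr (.inl k))), θ (.inr (.inr (.inl k)))⟩)
      ((Real.log |s₁ / s₂| * logMod μ S α (s₁ • e k))⁻¹ •
          modulusDeriv (fun c => stableCharFun μ S α (gridPt s₁ s₂ c)) (.inl k) -
        (Real.log |s₁ / s₂| * logMod μ S α (s₂ • e k))⁻¹ •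
          modulusDeriv (fun c => stableCharFun μ S α (gridPt s₁ s₂ c)) (.inr (.inl k)))
      (reIm fun c => stableCharFun μ S α (gridPt s₁ s₂ c)) := by
  have h1 := hasFDerivAt_neg_log_modulus (S := S) μ α s₁ s₂ (.inl k)
  have h2 := hasFDerivAt_neg_log_modulus (S := S) μ α s₁ s₂ (.inr (.inl k))
  have e1 := neg_log_norm_smul_e (S := S) μ α s₁ k
  have e2 := neg_log_norm_smul_e (S := S) μ α s₂ k
  have p1 := Real.rpow_pos_of_pos (half_sq_mul_pos hS hSd hs₁ k) (α / 2)
  have p2 := Real.rpow_pos_of_pos (half_sq_mul_pos hS hSd hs₂ k) (α / 2)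
  rw [← e1] at p1
  rw [← e2] at p2
  have h := ((h1.log p1.ne').sub (h2.log p2.ne')).mul_const (Real.log |s₁ / s₂|)⁻¹
  refine (h.congr_fderiv ?_).congr_of_eventuallyEq ?_
  · simp only [gridPt, reIm, Sum.elim_inl, Sum.elim_inr, Complex.eta, e1, e2, logMod_smul_e,
      smul_sub, smul_smul, mul_inv, inv_neg]
    congr 2 <;> ring
  -- The logarithm of the quotient splits into a difference only where both terms are nonzero, which
  -- holds near the true values.
  · filter_upwards [h1.continuousAt.eventually_ne p1.ne', h2.continuousAt.eventually_ne p2.ne']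
      with θ n1 n2
    rw [alphaS, ← neg_div_neg_eq (Real.log ‖_‖), Real.log_div n1 n2, div_eq_mul_inv]
    rfl

/-- The derivative of `α̂^mult` at the true values. -/
noncomputable def alphaDeriv (S : Matrix (Fin p) (Fin p) ℝ) (s₁ s₂ : ℝ) :
    (CoordIdx p → ℝ) →L[ℝ] ℝ :=
  ∑ k, (coefA₁ μ S α s₁ s₂ k •
      modulusDeriv (fun c => stableCharFun μ S α (gridPt s₁ s₂ c)) (.inl k) +
    coefA₂ μ S α s₁ s₂ k •
      modulusDeriv (fun c => stableCharFun μ S α (gridPt s₁ s₂ c)) (.inr (.inl k)))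

theorem hasFDerivAt_alphaMult (hS : S.PosSemidef) (hSd : ∀ k, S k k ≠ 0)
    {s₁ s₂ : ℝ} (hs₁ : s₁ ≠ 0) (hs₂ : s₂ ≠ 0) :
    HasFDerivAt (fun θ : CoordIdx p → ℝ =>
        alphaMult s₁ s₂ fun c => (⟨θ (.inl c), θ (.inr c)⟩ : ℂ))
      (alphaDeriv μ α S s₁ s₂) (reIm fun c => stableCharFun μ S α (gridPt s₁ s₂ c)) := by
  have h := (HasFDerivAt.fun_sum (u := Finset.univ) fun k _ =>
    hasFDerivAt_alphaS μ α hS hSd hs₁ hs₂ k).const_mul (1 / (p : ℝ))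
  refine h.congr_fderiv ?_
  rw [alphaDeriv, Finset.smul_sum]
  refine Finset.sum_congr rfl fun k _ => ?_
  rw [smul_sub, smul_smul, smul_smul, sub_eq_add_neg, ← neg_smul, coefA₁, coefA₂]
  congr 2 <;> simp only [mul_inv, one_div] <;> ring

/-- Common source of the diagonal and off-diagonal rows. Allowing `q = 0` is needed for the points
`e_i ± e_j` when `S` is singular. -/
theorem hasFDerivAt_modulus_rpow (hp : 0 < p) (hα0 : 0 < α) (hα2 : α < 2) (hS : S.PosSemidef)
    (hSd : ∀ k, S k k ≠ 0) {s₁ s₂ : ℝ} (hs₁ : s₁ ≠ 0) (hs₂ : s₂ ≠ 0)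
    (hL : Real.log |s₁ / s₂| ≠ 0) (c : GridIdx p) {q : ℝ} (hq : 0 ≤ q)
    (hc : -Real.log ‖stableCharFun μ S α (gridPt s₁ s₂ c)‖ = q ^ (α / 2)) :
    HasFDerivAt (fun θ : CoordIdx p → ℝ =>
        (-Real.log ‖(⟨θ (.inl c), θ (.inr c)⟩ : ℂ)‖) ^
          (2 / alphaMult s₁ s₂ fun c => (⟨θ (.inl c), θ (.inr c)⟩ : ℂ)))
      ((-(2 / (α * ‖stableCharFun μ S α (gridPt s₁ s₂ c)‖) * q ^ (1 - α / 2))) •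
          modulusDeriv (fun c => stableCharFun μ S α (gridPt s₁ s₂ c)) c -
        (q * Real.log q / α) • alphaDeriv μ α S s₁ s₂)
      (reIm fun c => stableCharFun μ S α (gridPt s₁ s₂ c)) := by
  refine (hasFDerivAt_rpow_two_div hq hα0 hα2
    (hasFDerivAt_neg_log_modulus (S := S) μ α s₁ s₂ c)
    (hasFDerivAt_alphaMult μ α hS hSd hs₁ hs₂) hc
    (alphaMult_stableCharFun μ α hp hS hSd hs₁ hs₂ hL)).congr_fderiv ?_
  rw [smul_smul]
  congr 2
  rw [div_mul_eq_div_div]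
  ring

theorem qPlus_nonneg (hS : S.PosSemidef) (q : LowerPair p) : 0 ≤ qPlus S q := by
  rw [← quadForm_add hS]
  exact quadForm_nonneg hS _

theorem qMinus_nonneg (hS : S.PosSemidef) (q : LowerPair p) : 0 ≤ qMinus S q := by
  rw [← quadForm_sub hS]
  exact quadForm_nonneg hS _

theorem estimate_stableCharFun (hp : 0 < p) (hα0 : 0 < α) (hS : S.PosSemidef)
    (hSd : ∀ k, S k k ≠ 0) {s₁ s₂ : ℝ} (hs₁ : s₁ ≠ 0) (hs₂ : s₂ ≠ 0)
    (hL : Real.log |s₁ / s₂| ≠ 0) :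
    estimate s₁ s₂ (fun c : GridIdx p => stableCharFun μ S α (gridPt s₁ s₂ c)) = params α S := by
  have e2 : α / 2 * (2 / α) = 1 := by field_simp
  ext r
  rcases r with _ | j | q
  · exact alphaMult_stableCharFun μ α hp hS hSd hs₁ hs₂ hL
  · simp only [estimate, alphaMult_stableCharFun μ α hp hS hSd hs₁ hs₂ hL]
    simp only [sigmaDiag, gridPt, neg_log_norm_smul_e, params]
    rw [← Real.rpow_mul (half_sq_mul_pos hS hSd hs₁ j).le, e2, Real.rpow_one]
    field_simp
  · simp only [estimate, alphaMult_stableCharFun μ α hp hS hSd hs₁ hs₂ hL]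
    simp only [sigmaOff, gridPt, neg_log_norm_stableCharFun, params]
    rw [quadForm_add hS, quadForm_sub hS, ← Real.rpow_mul (qPlus_nonneg hS q),
      ← Real.rpow_mul (qMinus_nonneg hS q), e2, Real.rpow_one, Real.rpow_one, qPlus, qMinus]
    ring

/-! ### The explicit matrix `G` as a chain rule -/

theorem mulVec_jacobian_apply (s₁ s₂ : ℝ) (v : CoordIdx p → ℝ) (r : ParamIdx p) :
    (jacobian μ S α s₁ s₂ *ᵥ v) r = ∑ c, jacAbs μ S α s₁ s₂ r c *
      modulusDeriv (fun c => stableCharFun μ S α (gridPt s₁ s₂ c)) c v := by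
  rw [Matrix.mulVec, dotProduct, Fintype.sum_sum_type, ← Finset.sum_add_distrib]
  refine Finset.sum_congr rfl fun c _ => ?_
  simp [jacobian, modulusDeriv]
  ring

/-- As `α̂` enters the scatter estimates only through the exponent, its contribution to their rows
is a scalar multiple of the `α` row. This and the next four identities extract the scalar; they hold
without nonzero denominators, since inversion is multiplicative with `0⁻¹ = 0`. -/
theorem coefB₁_eq (s₁ s₂ : ℝ) (j k : Fin p) :
    coefB₁ μ S α s₁ s₂ j k =
      -(S j j * Real.log (s₁ ^ 2 / 2 * S j j) / α) * coefA₁ μ S α s₁ s₂ k := by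
  simp only [coefB₁, coefA₁, div_eq_mul_inv, mul_inv]
  ring

theorem coefB₂_eq (s₁ s₂ : ℝ) (j k : Fin p) :
    coefB₂ μ S α s₁ s₂ j k =
      -(S j j * Real.log (s₁ ^ 2 / 2 * S j j) / α) * coefA₂ μ S α s₁ s₂ k := by
  simp only [coefB₂, coefA₂, div_eq_mul_inv, mul_inv]
  ring

theorem coefBd_eq (s₁ s₂ : ℝ) (j : Fin p) :
    coefBd μ S α s₁ s₂ j = 2 * S j j / (α * logMod μ S α (s₁ • e j)) +
      -(S j j * Real.log (s₁ ^ 2 / 2 * S j j) / α) * coefA₁ μ S α s₁ s₂ j := by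
  rw [coefBd, coefA₁, mul_div_right_comm (s₁ ^ 2)]
  simp only [div_eq_mul_inv, mul_inv]
  ring

theorem coefD_div_eq (s₁ s₂ : ℝ) (q : LowerPair p) (k : Fin p) :
    coefD S α s₁ s₂ q / logMod μ S α (s₁ • e k) =
      -((qPlus S q * Real.log (qPlus S q) - qMinus S q * Real.log (qMinus S q)) / (2 * α)) *
        coefA₁ μ S α s₁ s₂ k := by
  simp only [coefD, coefA₁, div_eq_mul_inv, mul_inv]
  ring

theorem neg_coefD_div_eq (s₁ s₂ : ℝ) (q : LowerPair p) (k : Fin p) :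
    -coefD S α s₁ s₂ q / logMod μ S α (s₂ • e k) =
      -((qPlus S q * Real.log (qPlus S q) - qMinus S q * Real.log (qMinus S q)) / (2 * α)) *
        coefA₂ μ S α s₁ s₂ k := by
  simp only [coefD, coefA₂, div_eq_mul_inv, mul_inv]
  ring

theorem alphaDeriv_apply (s₁ s₂ : ℝ) (v : CoordIdx p → ℝ) :
    alphaDeriv μ α S s₁ s₂ v = ∑ k, coefA₁ μ S α s₁ s₂ k *
        modulusDeriv (fun c => stableCharFun μ S α (gridPt s₁ s₂ c)) (.inl k) v +
      ∑ k, coefA₂ μ S α s₁ s₂ k *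
        modulusDeriv (fun c => stableCharFun μ S α (gridPt s₁ s₂ c)) (.inr (.inl k)) v := by
  simp [alphaDeriv, Finset.sum_add_distrib]

theorem sum_jacAbs_diag (s₁ s₂ : ℝ) (j : Fin p) (w : GridIdx p → ℝ) :
    ∑ c, jacAbs μ S α s₁ s₂ (.inr (.inl j)) c * w c =
      2 * S j j / (α * logMod μ S α (s₁ • e j)) * w (.inl j) +
        -(S j j * Real.log (s₁ ^ 2 / 2 * S j j) / α) *
          (∑ k, coefA₁ μ S α s₁ s₂ k * w (.inl k) +
            ∑ k, coefA₂ μ S α s₁ s₂ k * w (.inr (.inl k))) := by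
  have h : ∀ k, (if j = k then coefBd μ S α s₁ s₂ j else coefB₁ μ S α s₁ s₂ j k) =
      (if j = k then 2 * S j j / (α * logMod μ S α (s₁ • e j)) else 0) +
        -(S j j * Real.log (s₁ ^ 2 / 2 * S j j) / α) * coefA₁ μ S α s₁ s₂ k := by
    intro k
    split_ifs with hk
    · rw [← hk, coefBd_eq]
    · rw [coefB₁_eq, zero_add]
  simp only [Fintype.sum_sum_type, jacAbs, h, coefB₂_eq, add_mul, Finset.sum_add_distrib, ite_mul,
    zero_mul, Finset.sum_ite_eq, Finset.mem_univ, if_true, Finset.sum_const_zero, mul_add,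
    Finset.mul_sum, mul_assoc]
  ring

theorem sum_jacAbs_off (s₁ s₂ : ℝ) (q : LowerPair p) (w : GridIdx p → ℝ) :
    ∑ c, jacAbs μ S α s₁ s₂ (.inr (.inr q)) c * w c =
      dPlus μ S α q * w (.inr (.inr (.inl q))) + dMinus μ S α q * w (.inr (.inr (.inr q))) +
      -((qPlus S q * Real.log (qPlus S q) - qMinus S q * Real.log (qMinus S q)) / (2 * α)) *
          (∑ k, coefA₁ μ S α s₁ s₂ k * w (.inl k) +
            ∑ k, coefA₂ μ S α s₁ s₂ k * w (.inr (.inl k))) := by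
  simp only [Fintype.sum_sum_type, jacAbs, coefD_div_eq, neg_coefD_div_eq, ite_mul, zero_mul,
    Finset.sum_ite_eq, Finset.mem_univ, if_true, mul_add, Finset.mul_sum, mul_assoc]
  ring

theorem hasFDerivAt_estMap (hp : 0 < p) (hα0 : 0 < α) (hα2 : α < 2) (hS : S.PosSemidef)
    (hSd : ∀ k, S k k ≠ 0) {s₁ s₂ : ℝ} (hs₁ : s₁ ≠ 0) (hs₂ : s₂ ≠ 0)
    (hL : Real.log |s₁ / s₂| ≠ 0) :
    HasFDerivAt (estMap s₁ s₂)
      (LinearMap.toContinuousLinearMap (Matrix.mulVecLin (jacobian μ S α s₁ s₂)))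
      (reIm fun c => stableCharFun μ S α (gridPt s₁ s₂ c)) := by
  rw [hasFDerivAt_pi']
  intro r
  have hcoe : ∀ v, ((ContinuousLinearMap.proj r).comp (LinearMap.toContinuousLinearMap
      (Matrix.mulVecLin (jacobian μ S α s₁ s₂)))) v = ∑ c, jacAbs μ S α s₁ s₂ r c *
      modulusDeriv (fun c => stableCharFun μ S α (gridPt s₁ s₂ c)) c v :=
    fun v => mulVec_jacobian_apply μ α s₁ s₂ v r
  rcases r with _ | j | q
  · refine (hasFDerivAt_alphaMult μ α hS hSd hs₁ hs₂).congr_fderiv ?_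
    ext v
    rw [hcoe]
    simp [alphaDeriv, Fintype.sum_sum_type, jacAbs, Finset.sum_add_distrib]
  · have hq := half_sq_mul_pos hS hSd hs₁ j
    have h := (hasFDerivAt_modulus_rpow μ α hp hα0 hα2 hS hSd hs₁ hs₂ hL (.inl j) hq.le
      (neg_log_norm_smul_e μ α s₁ j)).const_mul (2 / s₁ ^ 2)
    refine h.congr_fderiv ?_
    ext v
    rw [hcoe, sum_jacAbs_diag, ← alphaDeriv_apply, logMod_smul_e]
    have hs : S j j = 2 / s₁ ^ 2 * (s₁ ^ 2 / 2 * S j j) := by field_simp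
    have hne := norm_ne_zero_iff.2 (stableCharFun_ne_zero μ S α (s₁ • e j))
    have hqp := Real.rpow_pos_of_pos hq (α / 2)
    simp only [gridPt, smul_apply, sub_apply, smul_eq_mul]
    -- Since `q > 0`, `q ^ (1 - α / 2) = q / q ^ (α / 2)`; the denominator combines with `‖φ‖` into
    -- `-logMod`, and `2 / s₁ ^ 2 * q` is `S j j`.
    rw [Real.rpow_sub hq, Real.rpow_one, mul_sub]
    rw [sub_eq_add_neg]
    congr 1
    · field_simp
    · field_simp
  · have h1 := hasFDerivAt_modulus_rpow μ α hp hα0 hα2 hS hSd hs₁ hs₂ hL (.inr (.inr (.inl q)))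
      (qPlus_nonneg hS q)
      ((neg_log_norm_stableCharFun μ S α _).trans (by rw [← quadForm_add hS]; rfl))
    have h2 := hasFDerivAt_modulus_rpow μ α hp hα0 hα2 hS hSd hs₁ hs₂ hL (.inr (.inr (.inr q)))
      (qMinus_nonneg hS q)
      ((neg_log_norm_stableCharFun μ S α _).trans (by rw [← quadForm_sub hS]; rfl))
    refine ((h1.fun_sub h2).mul_const (1 / 2)).congr_fderiv ?_ |>.congr_of_eventuallyEq
      (.of_forall fun θ => div_eq_mul_one_div _ _)
    ext v
    rw [hcoe, sum_jacAbs_off, ← alphaDeriv_apply]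
    simp only [gridPt, smul_apply, sub_apply, smul_eq_mul, dPlus, dMinus, div_eq_mul_inv, mul_inv]
    ring

end Jacobian

/-! ### Moments of `cos(tᵀx)` and `sin(tᵀx)`, and the matrix `Ω` -/

section CharFun

variable {p : ℕ} {Ω : Type*} [MeasurableSpace Ω] {P : Measure Ω}
  {X : Ω → EuclideanSpace ℝ (Fin p)}

theorem integral_exp_inner (hX : Measurable X) (t : EuclideanSpace ℝ (Fin p)) :
    ∫ ω, Complex.exp (Complex.I * ((inner ℝ t (X ω) : ℝ) : ℂ)) ∂P = charFun (P.map X) t := by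
  rw [charFun_apply, integral_map hX.aemeasurable (by fun_prop)]
  simp only [real_inner_comm, mul_comm]

variable [IsProbabilityMeasure P]

theorem integrable_exp_inner (hX : Measurable X) (t : EuclideanSpace ℝ (Fin p)) :
    Integrable (fun ω => Complex.exp (Complex.I * ((inner ℝ t (X ω) : ℝ) : ℂ))) P := by
  refine Integrable.of_bound (C := 1) (Measurable.aestronglyMeasurable (by fun_prop))
    (.of_forall fun ω => ?_)
  rw [mul_comm, Complex.norm_exp_ofReal_mul_I]

theorem integral_reIm_exp_inner {ι : Type*} (hX : Measurable X)
    (t : ι → EuclideanSpace ℝ (Fin p)) (a : ι ⊕ ι) :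
    ∫ ω, reIm (fun c => Complex.exp (Complex.I * ((inner ℝ (t c) (X ω) : ℝ) : ℂ))) a ∂P =
      reIm (fun c => charFun (P.map X) (t c)) a := by
  rcases a with c | c
  · simp only [reIm, Sum.elim_inl, ← integral_exp_inner hX]
    exact integral_re (integrable_exp_inner hX _)
  · simp only [reIm, Sum.elim_inr, ← integral_exp_inner hX]
    exact integral_im (integrable_exp_inner hX _)

theorem measurable_reIm_exp_inner {ι : Type*} (t : ι → EuclideanSpace ℝ (Fin p)) (a : ι ⊕ ι) :
    Measurable fun x : EuclideanSpace ℝ (Fin p) =>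
      reIm (fun c => Complex.exp (Complex.I * ((inner ℝ (t c) x : ℝ) : ℂ))) a := by
  rcases a with c | c
  · simp only [reIm, Sum.elim_inl]
    fun_prop
  · simp only [reIm, Sum.elim_inr]
    fun_prop

theorem memLp_reIm_exp_inner {ι : Type*} (hX : Measurable X)
    (t : ι → EuclideanSpace ℝ (Fin p)) (a : ι ⊕ ι) :
    MemLp (fun ω => reIm (fun c => Complex.exp (Complex.I * ((inner ℝ (t c) (X ω) : ℝ) : ℂ))) a)
      2 P := by
  refine MemLp.of_bound ((measurable_reIm_exp_inner t a).comp hX).aestronglyMeasurable 1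
    (.of_forall fun ω => ?_)
  have h : ∀ c, ‖Complex.exp (Complex.I * ((inner ℝ (t c) (X ω) : ℝ) : ℂ))‖ = 1 := fun c => by
    rw [mul_comm, Complex.norm_exp_ofReal_mul_I]
  rcases a with c | c
  · exact (Complex.abs_re_le_norm _).trans (h c).le
  · exact (Complex.abs_im_le_norm _).trans (h c).le

theorem integral_cos_inner (hX : Measurable X) (t : EuclideanSpace ℝ (Fin p)) :
    ∫ ω, Real.cos (inner ℝ t (X ω)) ∂P = (charFun (P.map X) t).re := by
  have h := integral_reIm_exp_inner (P := P) hX (fun _ : Unit => t) (.inl ())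
  simpa [reIm, mul_comm Complex.I, Complex.exp_ofReal_mul_I_re] using h

theorem integral_sin_inner (hX : Measurable X) (t : EuclideanSpace ℝ (Fin p)) :
    ∫ ω, Real.sin (inner ℝ t (X ω)) ∂P = (charFun (P.map X) t).im := by
  have h := integral_reIm_exp_inner (P := P) hX (fun _ : Unit => t) (.inr ())
  simpa [reIm, mul_comm Complex.I, Complex.exp_ofReal_mul_I_im] using h

theorem integrable_cos_inner (hX : Measurable X) (t : EuclideanSpace ℝ (Fin p)) :
    Integrable (fun ω => Real.cos (inner ℝ t (X ω))) P :=
  Integrable.of_bound (C := 1) (Measurable.aestronglyMeasurable (by fun_prop))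
    (.of_forall fun _ => Real.abs_cos_le_one _)

theorem integrable_sin_inner (hX : Measurable X) (t : EuclideanSpace ℝ (Fin p)) :
    Integrable (fun ω => Real.sin (inner ℝ t (X ω))) P :=
  Integrable.of_bound (C := 1) (Measurable.aestronglyMeasurable (by fun_prop))
    (.of_forall fun _ => Real.abs_sin_le_one _)

theorem integral_cos_mul_cos (hX : Measurable X) (s t : EuclideanSpace ℝ (Fin p)) :
    ∫ ω, Real.cos (inner ℝ s (X ω)) * Real.cos (inner ℝ t (X ω)) ∂P =
      1 / 2 * (charFun (P.map X) (s + t)).re + 1 / 2 * (charFun (P.map X) (t - s)).re := by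
  rw [← integral_cos_inner hX, ← integral_cos_inner hX, ← integral_const_mul, ← integral_const_mul,
    ← integral_add ((integrable_cos_inner hX _).const_mul _)
      ((integrable_cos_inner hX _).const_mul _)]
  refine integral_congr_ae (.of_forall fun ω => ?_)
  simp only [inner_add_left, inner_sub_left, Real.cos_add, Real.cos_sub]
  ring

theorem integral_sin_mul_sin (hX : Measurable X) (s t : EuclideanSpace ℝ (Fin p)) :
    ∫ ω, Real.sin (inner ℝ s (X ω)) * Real.sin (inner ℝ t (X ω)) ∂P =
      -(1 / 2 * (charFun (P.map X) (s + t)).re) + 1 / 2 * (charFun (P.map X) (t - s)).re := by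
  rw [← integral_cos_inner hX, ← integral_cos_inner hX, ← integral_const_mul, ← integral_const_mul,
    neg_add_eq_sub, ← integral_sub ((integrable_cos_inner hX _).const_mul _)
      ((integrable_cos_inner hX _).const_mul _)]
  refine integral_congr_ae (.of_forall fun ω => ?_)
  simp only [inner_add_left, inner_sub_left, Real.cos_add, Real.cos_sub]
  ring

theorem integral_cos_mul_sin (hX : Measurable X) (s t : EuclideanSpace ℝ (Fin p)) :
    ∫ ω, Real.cos (inner ℝ s (X ω)) * Real.sin (inner ℝ t (X ω)) ∂P =
      1 / 2 * (charFun (P.map X) (s + t)).im + 1 / 2 * (charFun (P.map X) (t - s)).im := by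
  rw [← integral_sin_inner hX, ← integral_sin_inner hX, ← integral_const_mul, ← integral_const_mul,
    ← integral_add ((integrable_sin_inner hX _).const_mul _)
      ((integrable_sin_inner hX _).const_mul _)]
  refine integral_congr_ae (.of_forall fun ω => ?_)
  simp only [inner_add_left, inner_sub_left, Real.sin_add, Real.sin_sub]
  ring

/-- The product-to-sum formulas turn mixed moments into values of the characteristic function at `t
k ± t j`; this holds for every law of `X`. -/
theorem Omega_eq_covariance {ι : Type*} (hX : Measurable X) (t : ι → EuclideanSpace ℝ (Fin p))
    (a b : ι ⊕ ι) :
    Omega (charFun (P.map X)) t a b =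
      cov[fun ω => reIm (fun c => Complex.exp (Complex.I * ((inner ℝ (t c) (X ω) : ℝ) : ℂ))) a,
          fun ω => reIm (fun c => Complex.exp (Complex.I * ((inner ℝ (t c) (X ω) : ℝ) : ℂ))) b;
          P] := by
  rw [covariance_eq_sub (memLp_reIm_exp_inner hX t a) (memLp_reIm_exp_inner hX t b),
    integral_reIm_exp_inner hX, integral_reIm_exp_inner hX]
  have hc := integral_cos_mul_cos (P := P) hX
  have hs := integral_sin_mul_sin (P := P) hX
  have hcs := integral_cos_mul_sin (P := P) hX
  rcases a with a | a <;> rcases b with b | b <;>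
    simp only [Pi.mul_apply, reIm, Sum.elim_inl, Sum.elim_inr, mul_comm Complex.I,
      Complex.exp_ofReal_mul_I_re, Complex.exp_ofReal_mul_I_im, Omega, Matrix.fromBlocks_apply₁₁,
      Matrix.fromBlocks_apply₁₂, Matrix.fromBlocks_apply₂₁, Matrix.fromBlocks_apply₂₂,
      Matrix.transpose_apply, Matrix.of_apply]
  · rw [hc]
  · rw [hcs]
  -- The lower left block is the transpose of the upper right one, so the two points exchange roles.
  · simp only [mul_comm (Real.sin _), hcs]
    ring
  · rw [hs]

end CharFun

/-! ### The limit law of the empirical characteristic function and of the estimator -/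

/-- Convergence in distribution requires measurability for every `n`, also on the event where a
logarithm, quotient or power takes its default value. -/
theorem measurable_estMap {p : ℕ} (s₁ s₂ : ℝ) : Measurable (estMap (p := p) s₁ s₂) := by
  have hnorm : ∀ c : GridIdx p, Measurable fun θ : CoordIdx p → ℝ =>
      ‖(⟨θ (.inl c), θ (.inr c)⟩ : ℂ)‖ := by
    intro c
    simp only [Complex.norm_def, Complex.normSq_apply]
    fun_prop
  have halpha : Measurable fun θ : CoordIdx p → ℝ =>
      alphaMult s₁ s₂ fun c => (⟨θ (.inl c), θ (.inr c)⟩ : ℂ) := by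
    simp only [alphaMult, alphaS]
    fun_prop
  rw [measurable_pi_iff]
  rintro (_ | j | q)
  · exact halpha
  · simp only [estMap, estimate, sigmaDiag]
    fun_prop
  · simp only [estMap, estimate, sigmaOff]
    fun_prop

theorem reIm_ecf {p n : ℕ} (x : ℕ → EuclideanSpace ℝ (Fin p))
    (t : GridIdx p → EuclideanSpace ℝ (Fin p)) :
    (reIm fun c => ecf n x (t c)) = (n : ℝ)⁻¹ • ∑ k ∈ Finset.range n,
      reIm fun c => Complex.exp (Complex.I * ((inner ℝ (t c) (x k) : ℝ) : ℂ)) := by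
  have hn : (1 / (n : ℂ)) = (((n : ℝ)⁻¹ : ℝ) : ℂ) := by simp
  ext (c | c) <;>
    simp only [reIm, ecf, hn, Sum.elim_inl, Sum.elim_inr, Complex.re_ofReal_mul,
      Complex.im_ofReal_mul, Complex.re_sum, Complex.im_sum, Pi.smul_apply, Finset.sum_apply,
      smul_eq_mul]

theorem sqrt_smul_inv_smul_sub {V : Type*} [AddCommGroup V] [Module ℝ V] (n : ℕ) (u m : V) :
    √(n : ℝ) • ((n : ℝ)⁻¹ • u - m) = (√(n : ℝ))⁻¹ • (u - (n : ℝ) • m) := by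
  rcases n.eq_zero_or_pos with rfl | hn
  · simp
  · have h : (0 : ℝ) < n := by exact_mod_cast hn
    rw [smul_sub, smul_sub, smul_smul, smul_smul]
    congr 2
    · rw [← div_eq_mul_inv, Real.sqrt_div_self]
    · rw [inv_mul_eq_div, Real.div_sqrt]

theorem log_abs_div_ne_zero {s₁ s₂ : ℝ} (hs₁ : s₁ ≠ 0) (hs₂ : s₂ ≠ 0) (hs : |s₁| ≠ |s₂|) :
    Real.log |s₁ / s₂| ≠ 0 := by
  have h1 : 0 < |s₁ / s₂| := abs_pos.2 (div_ne_zero hs₁ hs₂)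
  refine Real.log_ne_zero_of_pos_of_ne_one h1 ?_
  rw [abs_div]
  exact fun h => hs ((div_eq_one_iff_eq (abs_ne_zero.2 hs₂)).1 h)

/-- The vectors `ψ (X k)` of cosines and sines are bounded, independent and identically distributed,
so the central limit theorem applies even though `X k` itself may lack moments. -/
theorem tendstoInDistribution_ecf {p : ℕ} {φ : EuclideanSpace ℝ (Fin p) → ℂ}
    {Ω : Type*} [MeasurableSpace Ω] (P : Measure Ω) [IsProbabilityMeasure P]
    (X : ℕ → Ω → EuclideanSpace ℝ (Fin p)) (hX : ∀ j, Measurable (X j))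
    (hindep : iIndepFun X P) (hlaw : ∀ j, charFun (P.map (X j)) = φ)
    (t : GridIdx p → EuclideanSpace ℝ (Fin p)) :
    TendstoInDistribution
      (fun (n : ℕ) ω => √(n : ℝ) • ((reIm fun c => ecf n (fun j => X j ω) (t c)) -
        reIm fun c => φ (t c))) atTop (WithLp.ofLp : EuclideanSpace ℝ (CoordIdx p) → _)
      (fun _ => P) (multivariateGaussian 0 (Omega φ t)) := by
  let ψ : EuclideanSpace ℝ (Fin p) → EuclideanSpace ℝ (CoordIdx p) := fun x =>
    WithLp.toLp 2 (reIm fun c => Complex.exp (Complex.I * ((inner ℝ (t c) x : ℝ) : ℂ)))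
  have hψ : Measurable ψ :=
    (WithLp.measurable_toLp 2 _).comp (measurable_pi_iff.2 fun a => measurable_reIm_exp_inner t a)
  -- Equal characteristic functions force equal laws.
  have hident : ∀ i, IdentDistrib (X i) (X 0) P P := fun i => by
    refine ⟨(hX i).aemeasurable, (hX 0).aemeasurable, ?_⟩
    have := Measure.isProbabilityMeasure_map (μ := P) (hX i).aemeasurable
    have := Measure.isProbabilityMeasure_map (μ := P) (hX 0).aemeasurable
    exact Measure.ext_of_charFun ((hlaw i).trans (hlaw 0).symm)
  have h := tendstoInDistribution_multivariateGaussian (P := P) (Y := fun k ω => ψ (X k ω))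
    (m := WithLp.toLp 2 (reIm fun c => φ (t c))) (C := Omega φ t)
    (fun n => hψ.comp (hX n)) (memLp_reIm_exp_inner (hX 0) t)
    (hindep.comp (fun _ => ψ) fun _ => hψ) (fun i => (hident i).comp hψ)
    (fun a b => by rw [← hlaw 0]; exact Omega_eq_covariance (hX 0) t a b)
    (fun a => by rw [← hlaw 0]; exact (integral_reIm_exp_inner (hX 0) t a).symm)
  refine (h.continuous_comp (g := WithLp.ofLp) (by fun_prop)).congr
    (fun n => .of_forall fun ω => ?_) (.of_forall fun _ => rfl)
  simp only [Function.comp_apply, reIm_ecf, sqrt_smul_inv_smul_sub]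
  simp [ψ]

theorem theorem1 {p : ℕ} (hp : 0 < p)
    (μ : EuclideanSpace ℝ (Fin p)) (S : Matrix (Fin p) (Fin p) ℝ) (α : ℝ)
    (hα0 : 0 < α) (hα2 : α < 2) (hS : S.PosSemidef) (hSd : ∀ k, S k k ≠ 0)
    (s₁ s₂ : ℝ) (hs₁ : s₁ ≠ 0) (hs₂ : s₂ ≠ 0) (hs : |s₁| ≠ |s₂|)
    {Ω : Type*} [MeasurableSpace Ω] (P : Measure Ω) [IsProbabilityMeasure P]
    (X : ℕ → Ω → EuclideanSpace ℝ (Fin p)) (hX : ∀ j, Measurable (X j))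
    (hindep : iIndepFun X P)
    (hlaw : ∀ j, IsSubGaussianStable (P.map (X j)) μ S α) :
    let φ := stableCharFun μ S α
    let t : GridIdx p → EuclideanSpace ℝ (Fin p) := gridPt s₁ s₂
    let G : Matrix (ParamIdx p) (CoordIdx p) ℝ := jacobian μ S α s₁ s₂
    let Om : Matrix (CoordIdx p) (CoordIdx p) ℝ := Omega φ t
    -- `Om` is the covariance matrix of the real and imaginary parts of `exp (i tᵀ x)`
    (∀ a b : CoordIdx p, Om a b =
      cov[fun ω => reIm (fun c => Complex.exp (Complex.I * ((inner ℝ (t c) (X 0 ω) : ℝ) : ℂ))) a,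
          fun ω => reIm (fun c => Complex.exp (Complex.I * ((inner ℝ (t c) (X 0 ω) : ℝ) : ℂ))) b;
          P]) ∧
    -- `G` is the Jacobian matrix of the estimation map at the true values
    HasFDerivAt (estMap s₁ s₂) (LinearMap.toContinuousLinearMap (Matrix.mulVecLin G))
      (reIm fun c => φ (t c)) ∧
    (G * Om * Gᵀ).PosSemidef ∧
    -- the limit law
    TendstoInDistribution
      (fun (n : ℕ) (ω : Ω) =>
        (WithLp.toLp 2 (√(n : ℝ) • (estimator s₁ s₂ n (fun j => X j ω) - params α S)) :
          EuclideanSpace ℝ (ParamIdx p)))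
      atTop id (fun _ => P) (multivariateGaussian 0 (G * Om * Gᵀ)) := by
  intro φ t G Om
  have hL := log_abs_div_ne_zero hs₁ hs₂ hs
  have hchar : ∀ j, charFun (P.map (X j)) = φ := fun j => funext (hlaw j)
  have hOm : ∀ a b : CoordIdx p, Om a b =
      cov[fun ω => reIm (fun c => Complex.exp (Complex.I * ((inner ℝ (t c) (X 0 ω) : ℝ) : ℂ))) a,
          fun ω => reIm (fun c => Complex.exp (Complex.I * ((inner ℝ (t c) (X 0 ω) : ℝ) : ℂ))) b;
          P] := by
    intro a b
    rw [← Omega_eq_covariance (hX 0), hchar]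
  have hder : HasFDerivAt (estMap s₁ s₂) (LinearMap.toContinuousLinearMap (Matrix.mulVecLin G))
      (reIm fun c => φ (t c)) := hasFDerivAt_estMap μ α hp hα0 hα2 hS hSd hs₁ hs₂ hL
  have hOmpos : Om.PosSemidef := posSemidef_of_eq_covariance (memLp_reIm_exp_inner (hX 0) t) hOm
  have hpos : (G * Om * Gᵀ).PosSemidef := by simpa using hOmpos.mul_mul_conjTranspose_same G
  refine ⟨hOm, hder, hpos, ?_⟩
  have hT := tendstoInDistribution_ecf P X hX hindep hchar t
  have hecf : ∀ n, Measurable fun ω => reIm fun c => ecf n (fun j => X j ω) (t c) := by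
    intro n
    simp only [reIm_ecf]
    exact Measurable.const_smul (Finset.measurable_fun_sum _ fun k _ => (measurable_pi_iff.2
      fun a => measurable_reIm_exp_inner t a).comp (hX k)) (n : ℝ)⁻¹
  have hdelta := (TendstoInDistribution.delta_method hder hT fun n =>
    ((measurable_estMap s₁ s₂).comp (hecf n)).aemeasurable).continuous_comp
      (g := fun y => (WithLp.toLp 2 y : EuclideanSpace ℝ (ParamIdx p))) (by fun_prop)
  have htrue : estMap s₁ s₂ (reIm fun c => φ (t c)) = params α S :=
    estimate_stableCharFun μ α hp hα0 hS hSd hs₁ hs₂ hL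
  -- A complex number is definitionally the pair of its real and imaginary parts, so `estMap` after
  -- `reIm` is `estimate`.
  have hlim : ∀ (n : ℕ) (ω : Ω), estMap s₁ s₂ (reIm fun c => ecf n (fun j => X j ω) (t c)) =
      estimator s₁ s₂ n fun j => X j ω := fun _ _ => rfl
  simp only [htrue, hlim] at hdelta
  exact TendstoInDistribution.of_map_eq hdelta aemeasurable_id
    ((map_multivariateGaussian_mulVec hOmpos G).trans Measure.map_id.symm)
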